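/- Let $b \ge 2$ be an integer and let $\xi$ be an irrational real number. Let $(x_j)_{j\ge 1}$ be the $b$-ary expansion of $\xi$, i.e. the unique sequence of integers in $\{0,1,\ldots,b-1\}$ with $\xi = \lfloor \xi\rfloor + \sum_{j\ge 1} x_j b^{-j}$ and $x_j \ne b-1$ for infinitely many $j$. For $n \ge 1$ let $p(n,\xi,b)$ be the number of distinct blocks of length $n$ in this expansion, $$p(n,\xi,b) = \mathrm{Card}\,\{x_{j+1}x_{j+2}\cdots x_{j+n} : j \ge 0\}.$$ Let $\mu = \mu(\xi) \in [2,+\infty]$ be the irrationality exponent of $\xi$, i.e. the supremum of the real numbers $m$ for which the inequality $|\xi - p/q| < q^{-m}$ has infinitely many rational solutions $p/q$ with $q \ge 1$. If $\mu = 2$, then $$\limsup_{n\to+\infty} \frac{p(n,\xi,b)}{n} \ge \frac43 .$$ If $2 < \mu < +\infty$, then $$\limsup_{n\to+\infty} \frac{p(n,\xi,b)}{n} \ge 1 + \frac{\mu+1-\sqrt{81(\mu-2)^2-10\mu+29}}{8(\mu-2)} .$$ In both cases the limsup is taken in $[0,+\infty]$. -/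

import Mathlib

open Filter

/-- The `b`-ary expansion of the real number `ξ`: the digits of its fractional part.
The digit written `x_{j+1}` in mathematical notation is the value at `j`. -/
noncomputable def baryExpansion (ξ : ℝ) (b : ℕ) [NeZero b] : ℕ → Fin b :=
  Real.digits (Int.fract ξ) b

/-- The expansion represents the number: `ξ = ⌊ξ⌋ + ∑_{j ≥ 1} x_j / b ^ j`. -/
theorem baryExpansion_hasSum (ξ : ℝ) (b : ℕ) [NeZero b] (hb : 2 ≤ b) :
    HasSum (fun j : ℕ => ((baryExpansion ξ b j : ℕ) : ℝ) / (b : ℝ) ^ (j + 1))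
      (ξ - (⌊ξ⌋ : ℝ)) := by
  have h := Real.hasSum_ofDigitsTerm_digits (Int.fract ξ) (b := b) (by omega)
    ⟨Int.fract_nonneg ξ, Int.fract_lt_one ξ⟩
  have hf : (fun j : ℕ => ((baryExpansion ξ b j : ℕ) : ℝ) / (b : ℝ) ^ (j + 1)) =
      Real.ofDigitsTerm (Real.digits (Int.fract ξ) b) := by
    funext j
    rw [Real.ofDigitsTerm, div_eq_mul_inv]
    rfl
  rw [hf, Int.self_sub_floor]
  exact h

/-- Infinitely many digits of the expansion differ from `b - 1`. -/
theorem baryExpansion_infinite (ξ : ℝ) (b : ℕ) [NeZero b] (hb : 2 ≤ b) :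
    {j : ℕ | ((baryExpansion ξ b j : Fin b) : ℕ) ≠ b - 1}.Infinite := by
  intro hfin
  obtain ⟨N, hN⟩ := hfin.bddAbove
  have hx : Int.fract ξ ∈ Set.Ico (0 : ℝ) 1 := ⟨Int.fract_nonneg ξ, Int.fract_lt_one ξ⟩
  have htail : (fun i : ℕ => Real.digits (Int.fract ξ) b (i + (N + 1))) =
      fun _ => (⟨b - 1, by omega⟩ : Fin b) := by
    funext i
    apply Fin.ext
    by_contra hne
    have h := hN (a := i + (N + 1)) hne
    omega
  have h1 := Real.ofDigits_eq_sum_add_ofDigits (Real.digits (Int.fract ξ) b) (N + 1)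
  rw [htail, Real.ofDigits_const_last_eq_one' (by omega), Real.ofDigits_digits (by omega) hx] at h1
  have h2 := Real.ofDigits_digits_sum_eq (b := b) hx (N + 1)
  have h3 := Nat.lt_floor_add_one ((b : ℝ) ^ (N + 1) * Int.fract ξ)
  have hb0 : (b : ℝ) ^ (N + 1) ≠ 0 := pow_ne_zero _ (Nat.cast_ne_zero.mpr (NeZero.ne b))
  have h4 : (b : ℝ) ^ (N + 1) * Int.fract ξ = ⌊(b : ℝ) ^ (N + 1) * Int.fract ξ⌋₊ + 1 := by
    rw [← h2]
    conv_lhs => rw [h1]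
    rw [mul_add, mul_one, mul_inv_cancel₀ hb0]
  linarith

/-- The number `p(n, x)` of distinct blocks of length `n` occurring in the infinite word `x`. -/
noncomputable def subwordComplexity {A : Type*} (x : ℕ → A) (n : ℕ) : ℕ :=
  (Set.range fun j : ℕ => fun i : Fin n => x (j + i)).ncard

/-- The complexity function `n ↦ p(n, ξ, b)` of the real number `ξ` in base `b`. -/
noncomputable def complexityInBase (n : ℕ) (ξ : ℝ) (b : ℕ) [NeZero b] : ℕ :=
  subwordComplexity (baryExpansion ξ b) n

/-- The irrationality exponent of `ξ`: the supremum (possibly `+∞`) of the real numbers `m` such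
that `|ξ - p / q| < 1 / q ^ m` has infinitely many rational solutions `p / q` with `q ≥ 1`. -/
noncomputable def irrationalityExponent (ξ : ℝ) : EReal :=
  ⨆ (m : ℝ) (_ : {r : ℚ | ∃ (p : ℤ) (q : ℕ), 1 ≤ q ∧ r = (p : ℚ) / (q : ℚ) ∧
    |ξ - (p : ℝ) / (q : ℝ)| < 1 / (q : ℝ) ^ m}.Infinite), (m : EReal)

/-! Suppose `p(n) ≤ (1 + δ) n` for all large `n`. If two blocks of length `L` coincide at positions
`u < t`, then `ξ` is within `b ^ (-L) / Q` of a fraction of denominator `Q = b ^ t - b ^ u`. For `m`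
above the irrationality exponent this forces `t ≥ c L` with `c = 1 / (m - 1)` once `L` is large
(`exists_forall_repetition_ge`). Low complexity, however, produces earlier repetitions as soon as `c
^ 3 + c ^ 2 - 1 > δ (1 + c + c ^ 2)` (`false_of_complexity_le_of_repetition_ge`).

Since `δ < 1`, there are arbitrarily large levels `n` with `p(n + 1) = p(n) + 1`. There a single
right special block exists, with two extensions, so the word travels along two loops based at it: a
run of first loops, a run of second loops, then the first loop again.
`FirstRepeat.exists_repetitions` extracts from these runs two long repetitions and bounds on their
positions. Levels where `p` grows by at least two bound the lengths of the runs. To have enough such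
levels, the position `i` of the first repeated block is taken minimal over all large levels of
growth one; then `n` is the last level of growth one along that repetition.

Letting `c` tend to `1 / (1 + t)`, `t = μ - 2`, gives a cubic condition on `t` and `δ`; the stated
bound is a root of a quadratic that implies it. -/

/-- The blocks of length `n` of the word `x` starting at the positions `s` and `t` coincide. -/
def BlockEq {A : Type*} (x : ℕ → A) (n s t : ℕ) : Prop := ∀ k < n, x (s + k) = x (t + k)

/-- No two distinct suffixes of `x` coincide. -/
def NotEventuallyPeriodic {A : Type*} (x : ℕ → A) : Prop :=
  ∀ s t, s < t → ∃ k, x (s + k) ≠ x (t + k)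

/-- The block of length `n` at position `r` has two distinct right extensions in `x`. -/
def RightSpecialAt {A : Type*} (x : ℕ → A) (n r : ℕ) : Prop :=
  ∃ v, BlockEq x n r v ∧ x (r + n) ≠ x (v + n)

/-- The first repetition of a block of length `n` in `x` is at position `j`, where the block of
position `i` reappears. -/
def FirstRepeat {A : Type*} (x : ℕ → A) (n i j : ℕ) : Prop :=
  i < j ∧ BlockEq x n i j ∧ ∀ u t, u < t → BlockEq x n u t → j ≤ t

/-! ### Coinciding blocks and right special positions -/

section BlockEq

variable {A : Type*} {x : ℕ → A} {n m s t u : ℕ}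

theorem BlockEq.refl (x : ℕ → A) (n s : ℕ) : BlockEq x n s s := fun _ _ => rfl

theorem BlockEq.symm (h : BlockEq x n s t) : BlockEq x n t s := fun k hk => (h k hk).symm

theorem BlockEq.trans (h : BlockEq x n s t) (h' : BlockEq x n t u) : BlockEq x n s u :=
  fun k hk => (h k hk).trans (h' k hk)

theorem BlockEq.mono (h : BlockEq x n s t) (hm : m ≤ n) : BlockEq x m s t :=
  fun k hk => h k (by omega)

theorem BlockEq.shift (h : BlockEq x n s t) (d : ℕ) (hm : m + d ≤ n) :
    BlockEq x m (s + d) (t + d) := fun k hk => by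
  have := h (d + k) (by omega)
  rwa [← add_assoc, ← add_assoc] at this

theorem BlockEq.append (h : BlockEq x n s t) (h' : BlockEq x m (s + n) (t + n)) :
    BlockEq x (n + m) s t := fun k hk => by
  by_cases hkn : k < n
  · exact h k hkn
  · have := h' (k - n) (by omega)
    rwa [show s + n + (k - n) = s + k by omega, show t + n + (k - n) = t + k by omega] at this

theorem BlockEq.succ (h : BlockEq x n s t) (h' : x (s + n) = x (t + n)) :
    BlockEq x (n + 1) s t := fun k hk => by
  rcases Nat.lt_succ_iff_lt_or_eq.1 hk with h1 | rfl
  · exact h k h1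
  · exact h'

theorem BlockEq.next (h : BlockEq x n s t) (h' : x (s + n) = x (t + n)) :
    BlockEq x n (s + 1) (t + 1) := (h.succ h').shift 1 le_rfl

theorem block_eq_iff : ((fun i : Fin n => x (s + i)) = fun i : Fin n => x (t + i)) ↔
    BlockEq x n s t :=
  ⟨fun h k hk => congrFun h ⟨k, hk⟩, fun h => funext fun i => h i i.2⟩

/-- A repetition with shift `d` propagates to all multiples of `d` inside the periodic run. -/
theorem BlockEq.periodic {d M : ℕ} (h : BlockEq x M s (s + d)) (hu : s ≤ u) (k : ℕ)
    (hk : u + k * d + n ≤ s + d + M) : BlockEq x n u (u + k * d) := by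
  induction k with
  | zero => simpa using BlockEq.refl x n u
  | succ k ih =>
    rw [Nat.succ_mul] at hk ⊢
    refine (ih (by omega)).trans ?_
    have := h.shift (m := n) (u + k * d - s) (by omega)
    rwa [show s + (u + k * d - s) = u + k * d by omega,
      show s + d + (u + k * d - s) = u + (k * d + d) by omega] at this

theorem exists_maximal_blockEq (hx : NotEventuallyPeriodic x) {s t n : ℕ} (hst : s < t)
    (h : BlockEq x n s t) :
    ∃ N, n ≤ N ∧ BlockEq x N s t ∧ x (s + N) ≠ x (t + N) := by
  classical
  have hex := hx s t hst
  refine ⟨Nat.find hex, ?_, fun k hk => not_not.1 (Nat.find_min hex hk), Nat.find_spec hex⟩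
  by_contra hlt
  exact Nat.find_spec hex (h _ (by omega))

theorem subwordComplexity_le_card (s : Finset ℕ)
    (hs : ∀ t, ∃ u ∈ s, BlockEq x n u t) : subwordComplexity x n ≤ s.card := by
  classical
  unfold subwordComplexity
  rw [← Set.ncard_coe_finset s]
  calc _ ≤ ((fun j => fun i : Fin n => x (j + i)) '' (s : Set ℕ)).ncard := by
        refine Set.ncard_le_ncard ?_ (Set.toFinite _)
        rintro _ ⟨t, rfl⟩
        obtain ⟨u, hu, h⟩ := hs t
        exact ⟨u, hu, block_eq_iff.2 h⟩
    _ ≤ _ := Set.ncard_image_le (Set.toFinite _)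

/-- A block is followed by the same letter at each of its occurrences, unless it is right
special. -/
theorem BlockEq.next_of_not_special {s t : ℕ} (h : BlockEq x n s t)
    (hs : ¬ RightSpecialAt x n s) : BlockEq x n (s + 1) (t + 1) :=
  h.next (not_not.1 fun hne => hs ⟨t, h, hne⟩)

theorem RightSpecialAt.congr {s t : ℕ} (hs : RightSpecialAt x n s) (h : BlockEq x n s t) :
    RightSpecialAt x n t := by
  obtain ⟨v, hv, hne⟩ := hs
  by_cases h' : x (t + n) = x (v + n)
  · exact ⟨s, h.symm, fun h'' => hne (h''.symm.trans h')⟩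
  · exact ⟨v, h.symm.trans hv, h'⟩

/-- Away from right special blocks the next letter is forced, so two occurrences of a block advance
in parallel. -/
theorem BlockEq.advance {s t : ℕ} (h : BlockEq x n s t) (k : ℕ)
    (hs : ∀ r, s ≤ r → r < s + k → ¬ RightSpecialAt x n r) :
    BlockEq x n (s + k) (t + k) ∧ BlockEq x (n + k) s t := by
  induction k with
  | zero => exact ⟨h, h⟩
  | succ k ih =>
    obtain ⟨h1, h2⟩ := ih fun r hr hr' => hs r hr (by omega)
    have hns := hs (s + k) (by omega) (by omega)
    refine ⟨h1.next_of_not_special hns, h2.succ ?_⟩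
    have := not_not.1 fun hne => hns ⟨t + k, h1, hne⟩
    rwa [show s + (n + k) = s + k + n by omega, show t + (n + k) = t + k + n by omega]

/-- A loop contains an occurrence of a right special block. -/
theorem exists_special_of_blockEq (hx : NotEventuallyPeriodic x) {s t : ℕ} (hst : s < t)
    (h : BlockEq x n s t) : ∃ r, s ≤ r ∧ r < t ∧ RightSpecialAt x n r := by
  by_contra hno
  push Not at hno
  -- Both positions advance forever: a position past `t` copies one that is `t - s` earlier, so it
  -- is not special either. This contradicts the end of the maximal coincidence, where the last
  -- block is special.
  have key : ∀ k, BlockEq x n (s + k) (t + k) ∧ ¬ RightSpecialAt x n (s + k) := by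
    intro k
    induction k using Nat.strong_induction_on with
    | _ k ih =>
      have h1 : BlockEq x n (s + k) (t + k) := by
        rcases k with _ | k
        · exact h
        · exact (ih k (by omega)).1.next_of_not_special (ih k (by omega)).2
      refine ⟨h1, ?_⟩
      by_cases hk : s + k < t
      · exact hno _ (by omega) hk
      · obtain ⟨h2, h3⟩ := ih (k - (t - s)) (by omega)
        rw [show t + (k - (t - s)) = s + k by omega] at h2
        exact fun hsp => h3 (hsp.congr h2.symm)
  obtain ⟨N, hN, h1, h2⟩ := exists_maximal_blockEq hx hst h
  refine (key (N - n)).2 ⟨t + (N - n), (key _).1, ?_⟩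
  rwa [show s + (N - n) + n = s + N by omega, show t + (N - n) + n = t + N by omega]

end BlockEq

/-! ### Counting blocks; levels where the complexity grows by one -/

section Complexity

variable {A : Type*} [Finite A] {x : ℕ → A} {n : ℕ}

theorem card_le_subwordComplexity (s : Finset ℕ)
    (hs : ∀ u ∈ s, ∀ t ∈ s, BlockEq x n u t → u = t) : s.card ≤ subwordComplexity x n := by
  unfold subwordComplexity
  rw [← Set.ncard_coe_finset s]
  refine Set.ncard_le_ncard_of_injOn (fun j => fun i : Fin n => x (j + i)) (fun j _ => ⟨j, rfl⟩)
    (fun u hu t ht hut => hs u hu t ht (block_eq_iff.1 hut)) (Set.toFinite _)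

/-- One representative position for every block of length `n`. -/
theorem exists_block_representatives (x : ℕ → A) (n : ℕ) :
    ∃ s : Finset ℕ, s.card = subwordComplexity x n ∧ (∀ t, ∃ u ∈ s, BlockEq x n u t) ∧
      ∀ u ∈ s, ∀ t ∈ s, BlockEq x n u t → u = t := by
  classical
  have hfin : (Set.range fun j : ℕ => fun i : Fin n => x (j + i)).Finite := Set.toFinite _
  choose! f hf using fun (w : Fin n → A)
    (hw : w ∈ Set.range fun j : ℕ => fun i : Fin n => x (j + i)) => hw
  have hinj : Set.InjOn f (Set.range fun j : ℕ => fun i : Fin n => x (j + i)) := by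
    intro w hw w' hw' h
    rw [← hf w hw, ← hf w' hw', h]
  refine ⟨hfin.toFinset.image f, ?_, ?_, ?_⟩
  · rw [Finset.card_image_of_injOn (by simpa using hinj), subwordComplexity,
      Set.ncard_eq_toFinset_card _ hfin]
  · intro t
    refine ⟨f (fun i : Fin n => x (t + i)), ?_, ?_⟩
    · exact Finset.mem_image_of_mem _ (by simp)
    · exact block_eq_iff.1 (hf _ ⟨t, rfl⟩)
  · intro u hu t ht h
    obtain ⟨w, hw, rfl⟩ := Finset.mem_image.1 hu
    obtain ⟨w', hw', rfl⟩ := Finset.mem_image.1 ht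
    rw [Set.Finite.mem_toFinset] at hw hw'
    have := block_eq_iff.2 h
    have h1 := hf w hw
    have h2 := hf w' hw'
    simp only at h1 h2
    rw [h1, h2] at this
    rw [this]

theorem exists_blockEq_lt (x : ℕ → A) (n m : ℕ) : ∃ s t, m ≤ s ∧ s < t ∧ BlockEq x n s t := by
  obtain ⟨s, t, hne, h⟩ := Finite.exists_ne_map_eq_of_infinite
    (fun j : ℕ => fun i : Fin n => x (m + j + i))
  rcases lt_or_gt_of_ne hne with h' | h'
  · exact ⟨m + s, m + t, by omega, by omega, block_eq_iff.1 h⟩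
  · exact ⟨m + t, m + s, by omega, by omega, block_eq_iff.1 h.symm⟩

theorem exists_firstRepeat (x : ℕ → A) (n : ℕ) : ∃ i j, FirstRepeat x n i j := by
  classical
  have hex : ∃ t s, s < t ∧ BlockEq x n s t := by
    obtain ⟨s, t, -, h, h'⟩ := exists_blockEq_lt x n 0
    exact ⟨t, s, h, h'⟩
  obtain ⟨i, hi, h⟩ := Nat.find_spec hex
  exact ⟨i, Nat.find hex, hi, h, fun u t hut h' => Nat.find_min' hex ⟨u, hut, h'⟩⟩

theorem exists_special_ge (hx : NotEventuallyPeriodic x) (n m : ℕ) :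
    ∃ r, m ≤ r ∧ RightSpecialAt x n r := by
  obtain ⟨s, t, hm, hst, h⟩ := exists_blockEq_lt x n m
  obtain ⟨r, hr, -, hr'⟩ := exists_special_of_blockEq hx hst h
  exact ⟨r, by omega, hr'⟩

/-- The least right special position not before `m`. -/
theorem exists_next_special (hx : NotEventuallyPeriodic x) (n m : ℕ) :
    ∃ r, m ≤ r ∧ RightSpecialAt x n r ∧ ∀ r', m ≤ r' → r' < r → ¬ RightSpecialAt x n r' := by
  classical
  have hex := exists_special_ge hx n m
  exact ⟨Nat.find hex, (Nat.find_spec hex).1, (Nat.find_spec hex).2,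
    fun r' h1 h2 h3 => Nat.find_min hex h2 ⟨h1, h3⟩⟩

/-- Two extensions of one right special block share their prefix of length `n`, so one of them can
be dropped while all blocks of length `n` remain covered. -/
theorem subwordComplexity_lt_succ (hx : NotEventuallyPeriodic x) (n : ℕ) :
    subwordComplexity x n < subwordComplexity x (n + 1) := by
  classical
  obtain ⟨s, hcard, hcov, hs⟩ := exists_block_representatives x (n + 1)
  obtain ⟨r, -, v, hrv, hne⟩ := exists_special_ge hx n 0
  obtain ⟨r', hr', h1⟩ := hcov r
  obtain ⟨v', hv', h2⟩ := hcov v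
  have hne' : r' ≠ v' := by
    rintro rfl
    exact hne ((h1.symm.trans h2) n (by omega))
  rw [← hcard, ← Finset.card_erase_add_one hv', Nat.lt_succ_iff]
  refine subwordComplexity_le_card _ fun t => ?_
  obtain ⟨u, hu, h⟩ := hcov t
  by_cases huv : u = v'
  · subst huv
    refine ⟨r', Finset.mem_erase.2 ⟨hne', hr'⟩, ?_⟩
    exact ((h1.mono (by omega)).trans hrv).trans ((h2.symm.trans h).mono (by omega))
  · exact ⟨u, Finset.mem_erase.2 ⟨huv, hu⟩, h.mono (by omega)⟩

/-- The Morse–Hedlund bound. -/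
theorem lt_subwordComplexity (hx : NotEventuallyPeriodic x) (n : ℕ) :
    n < subwordComplexity x n := by
  induction n with
  | zero =>
    have := card_le_subwordComplexity (x := x) (n := 0) {0} (by simp)
    simpa [Nat.one_le_iff_ne_zero, Nat.pos_iff_ne_zero] using this
  | succ n ih => have := subwordComplexity_lt_succ hx n; omega

/-- If two blocks of length `n + 1` are removed without losing any block of length `n`, then the
complexity increases by at least two. -/
theorem add_two_le_subwordComplexity_succ {a a' b b' : ℕ} (ha : BlockEq x n a a')
    (hb : BlockEq x n b b') (hab : ¬ BlockEq x (n + 1) a b) (haa : ¬ BlockEq x (n + 1) a a')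
    (hab' : ¬ BlockEq x (n + 1) a b') (hba : ¬ BlockEq x (n + 1) b a')
    (hbb : ¬ BlockEq x (n + 1) b b') :
    subwordComplexity x n + 2 ≤ subwordComplexity x (n + 1) := by
  classical
  obtain ⟨s, hcard, hcov, hs⟩ := exists_block_representatives x (n + 1)
  obtain ⟨a1, ha1, h1⟩ := hcov a
  obtain ⟨a2, ha2, h2⟩ := hcov a'
  obtain ⟨b1, hb1, h3⟩ := hcov b
  obtain ⟨b2, hb2, h4⟩ := hcov b'
  have n1 : b1 ≠ a1 := by rintro rfl; exact hab (h1.symm.trans h3)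
  have n2 : a2 ≠ a1 := by rintro rfl; exact haa (h1.symm.trans h2)
  have n3 : b2 ≠ a1 := by rintro rfl; exact hab' (h1.symm.trans h4)
  have n4 : a2 ≠ b1 := by rintro rfl; exact hba (h3.symm.trans h2)
  have n5 : b2 ≠ b1 := by rintro rfl; exact hbb (h3.symm.trans h4)
  have hb1' : b1 ∈ s.erase a1 := Finset.mem_erase.2 ⟨n1, hb1⟩
  rw [← hcard, ← Finset.card_erase_add_one ha1, ← Finset.card_erase_add_one hb1']
  have : subwordComplexity x n ≤ ((s.erase a1).erase b1).card := by
    refine subwordComplexity_le_card _ fun t => ?_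
    obtain ⟨u, hu, h⟩ := hcov t
    by_cases hua : u = a1
    · subst hua
      exact ⟨a2, by simp [*], ((h2.mono (by omega)).trans ha.symm).trans
        ((h1.symm.trans h).mono (by omega))⟩
    by_cases hub : u = b1
    · subst hub
      exact ⟨b2, by simp [*], ((h4.mono (by omega)).trans hb.symm).trans
        ((h3.symm.trans h).mono (by omega))⟩
    · exact ⟨u, by simp [*], h.mono (by omega)⟩
  omega

/-- If the complexity increases by one, then there is only one right special block. -/
theorem RightSpecialAt.blockEq (hp : subwordComplexity x (n + 1) = subwordComplexity x n + 1)
    {r r' : ℕ} (hr : RightSpecialAt x n r) (hr' : RightSpecialAt x n r') : BlockEq x n r r' := by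
  by_contra hne
  obtain ⟨v, hv, h1⟩ := hr
  obtain ⟨v', hv', h2⟩ := hr'
  have := add_two_le_subwordComplexity_succ hv hv'
    (fun h => hne (h.mono (by omega))) (fun h => h1 (h n (by omega)))
    (fun h => hne ((h.mono (by omega)).trans hv'.symm))
    (fun h => hne (hv.trans (h.mono (by omega)).symm)) (fun h => h2 (h n (by omega)))
  omega

/-- If the complexity increases by one, then the right special block has two extensions. -/
theorem eq_of_special_of_ne (hp : subwordComplexity x (n + 1) = subwordComplexity x n + 1)
    {r s t : ℕ} (hr : RightSpecialAt x n r) (hs : RightSpecialAt x n s)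
    (ht : RightSpecialAt x n t) (h1 : x (s + n) ≠ x (r + n)) (h2 : x (t + n) ≠ x (r + n)) :
    x (s + n) = x (t + n) := by
  by_contra hne
  have := add_two_le_subwordComplexity_succ (hs.blockEq hp hr) (ht.blockEq hp hr)
    (fun h => hne (h n (by omega))) (fun h => h1 (h n (by omega)))
    (fun h => h1 (h n (by omega))) (fun h => h2 (h n (by omega))) (fun h => h2 (h n (by omega)))
  omega

end Complexity

/-! ### Runs of loops at the right special block -/

section Runs

variable {A : Type*} {x : ℕ → A} {n : ℕ}

theorem BlockEq.advance_to_special {u v r : ℕ} (h : BlockEq x n u v) (hur : u ≤ r)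
    (hr : RightSpecialAt x n r) (hno : ∀ w, u ≤ w → w < r → ¬ RightSpecialAt x n w) :
    BlockEq x (n + (r - u)) u v ∧ RightSpecialAt x n (v + (r - u)) ∧
      ∀ w, v ≤ w → w < v + (r - u) → ¬ RightSpecialAt x n w := by
  obtain ⟨h1, h2⟩ := h.advance (r - u) fun w hw hw' => hno w hw (by omega)
  rw [show u + (r - u) = r by omega] at h1
  refine ⟨h2, hr.congr h1, fun w hw hw' hs => ?_⟩
  have h3 := h2.shift (m := n) (w - v) (by omega)
  rw [show v + (w - v) = w by omega] at h3
  exact hno (u + (w - v)) (by omega) (by omega) (hs.congr h3.symm)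

theorem BlockEq.join {a b s t s' t' d : ℕ} (h : BlockEq x a s t) (h' : BlockEq x b s' t')
    (hs : s' = s + d) (ht : t' = t + d) (hd : d ≤ a) : BlockEq x (b + d) s t := by
  subst hs ht
  rw [add_comm]
  exact (h.mono hd).append h'

theorem NotEventuallyPeriodic.shift (hx : NotEventuallyPeriodic x) (d : ℕ) :
    NotEventuallyPeriodic fun k => x (d + k) := by
  intro s t hst
  obtain ⟨k, hk⟩ := hx (d + s) (d + t) (by omega)
  exact ⟨k, by simpa only [add_assoc] using hk⟩

theorem blockEq_shift_iff {d s t : ℕ} :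
    BlockEq (fun k => x (d + k)) n s t ↔ BlockEq x n (d + s) (d + t) := by
  simp only [BlockEq, add_assoc]

variable [Finite A]

/-- The maximal run of loops of the same type starting at two consecutive right special positions
`r₀ < r₁`. -/
theorem exists_special_run (hx : NotEventuallyPeriodic x)
    (hp : subwordComplexity x (n + 1) = subwordComplexity x n + 1) {r₀ r₁ : ℕ} (h01 : r₀ < r₁)
    (h0 : RightSpecialAt x n r₀) (h1 : RightSpecialAt x n r₁)
    (hno : ∀ r, r₀ < r → r < r₁ → ¬ RightSpecialAt x n r) :
    ∃ K, n ≤ K ∧ BlockEq x K r₀ r₁ ∧ x (r₀ + K) ≠ x (r₁ + K) ∧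
      RightSpecialAt x n (r₁ + (K - n)) ∧ x (r₁ + K) ≠ x (r₀ + n) ∧
      (∀ r, r₀ ≤ r → r < r₁ + (K - n) → RightSpecialAt x n r → x (r + n) = x (r₀ + n)) ∧
      ∃ k, K - n = k * (r₁ - r₀) := by
  obtain ⟨K, hnK, hK, hne⟩ := exists_maximal_blockEq hx h01 (h0.blockEq hp h1)
  -- The last coinciding blocks of length `n` are followed by different letters, so both are right
  -- special.
  have e1 := hK.shift (m := n) (K - n) (by omega)
  have hne' : x (r₀ + (K - n) + n) ≠ x (r₁ + (K - n) + n) := by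
    rwa [show r₀ + (K - n) + n = r₀ + K by omega, show r₁ + (K - n) + n = r₁ + K by omega]
  have s0 : RightSpecialAt x n (r₀ + (K - n)) := ⟨_, e1, hne'⟩
  have s1 : RightSpecialAt x n (r₁ + (K - n)) := s0.congr e1
  have hlet : ∀ r, r₀ ≤ r → r < r₁ + (K - n) → RightSpecialAt x n r →
      x (r + n) = x (r₀ + n) := by
    intro r
    induction r using Nat.strong_induction_on with
    | _ r ih =>
      intro hr hr' hs
      by_cases hlt : r < r₁
      · rcases hr.eq_or_lt with rfl | hr
        · rfl
        · exact absurd hs (hno r hr hlt)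
      · have h2 := hK.shift (m := n + 1) (r - r₁) (by omega)
        rw [show r₁ + (r - r₁) = r by omega] at h2
        rw [← h2 n (by omega)]
        exact ih _ (by omega) (by omega) (by omega) (hs.congr (h2.mono (by omega)).symm)
  refine ⟨K, hnK, hK, hne, s1, ?_, hlet, ?_⟩
  · have := hlet _ (by omega) (by omega) s0
    rw [← this, show r₀ + (K - n) + n = r₀ + K by omega]
    exact hne.symm
  · have hmul : ∀ r, r₁ ≤ r → r ≤ r₁ + (K - n) → RightSpecialAt x n r →
        ∃ k, r = r₁ + k * (r₁ - r₀) := by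
      intro r
      induction r using Nat.strong_induction_on with
      | _ r ih =>
        intro hr hr' hs
        by_cases hlt : r - (r₁ - r₀) < r₁
        · refine ⟨0, ?_⟩
          by_contra hne
          have h2 := hK.shift (m := n) (r - r₁) (by omega)
          rw [show r₁ + (r - r₁) = r by omega] at h2
          exact hno (r₀ + (r - r₁)) (by omega) (by omega) (hs.congr h2.symm)
        · have h2 := hK.shift (m := n) (r - r₁) (by omega)
          rw [show r₁ + (r - r₁) = r by omega,
            show r₀ + (r - r₁) = r - (r₁ - r₀) by omega] at h2
          obtain ⟨k, hk⟩ := ih (r - (r₁ - r₀)) (by omega) (by omega) (by omega)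
            (hs.congr h2.symm)
          exact ⟨k + 1, by rw [Nat.succ_mul]; omega⟩
    obtain ⟨k, hk⟩ := hmul _ (by omega) le_rfl s1
    exact ⟨k, by omega⟩

/-- The structure of the first repetition: the first right special position `e`, and the run of
loops of length `j - i` from `e` to `j + (N - n)`. -/
theorem FirstRepeat.exists_run (hx : NotEventuallyPeriodic x)
    (hp : subwordComplexity x (n + 1) = subwordComplexity x n + 1) {i j N : ℕ}
    (hr : FirstRepeat x n i j) (hnN : n ≤ N) (hN : BlockEq x N i j)
    (hN' : x (i + N) ≠ x (j + N)) :
    ∃ e, i ≤ e ∧ e < j ∧ RightSpecialAt x n e ∧ (∀ r < e, ¬ RightSpecialAt x n r) ∧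
      (∀ r, e < r → r < e + (j - i) → ¬ RightSpecialAt x n r) ∧
      RightSpecialAt x n (j + (N - n)) ∧ x (j + N) ≠ x (e + n) ∧
      (∀ r < j + (N - n), RightSpecialAt x n r → x (r + n) = x (e + n)) ∧
      ∃ k, j + (N - n) = e + (j - i) + k * (j - i) := by
  obtain ⟨hij, hE, hmin⟩ := hr
  obtain ⟨e, -, he, hemin⟩ := exists_next_special hx n 0
  obtain ⟨r, hir, hrs, hrmin⟩ := exists_next_special hx n i
  obtain ⟨r', hr1, hr2, hr3⟩ := exists_special_of_blockEq hx hij hE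
  have hrj : r < j := by
    by_contra h
    exact hrmin r' hr1 (by omega) hr3
  -- A special position before `i` would carry the same block as `r < j`, a repetition ending before
  -- `j`.
  have hie : i ≤ e := by
    by_contra h
    have := hmin e r (by omega) (he.blockEq hp hrs)
    omega
  obtain rfl : e = r := by
    rcases lt_trichotomy e r with h | h | h
    · exact absurd he (hrmin e hie h)
    · exact h
    · exact absurd hrs (hemin r (by omega) h)
  obtain ⟨a1, a2, a3⟩ := hE.advance_to_special hie he hrmin
  have hej : j + (e - i) = e + (j - i) := by omega
  rw [hej] at a2 a3
  have hcons : ∀ r, e < r → r < e + (j - i) → ¬ RightSpecialAt x n r := by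
    intro r h1 h2 h3
    by_cases hj : r < j
    · have := hmin e r h1 (he.blockEq hp h3)
      omega
    · exact a3 r (by omega) h2 h3
  obtain ⟨K, hnK, hK, hKne, hs, hl, hall, k, hk⟩ :=
    exists_special_run hx hp (by omega) he a2 hcons
  have hKN : K + (e - i) = N := by
    have h1 := a1.join hK (d := e - i) (by omega) (by omega) (by omega)
    rcases lt_trichotomy (K + (e - i)) N with h | h | h
    · have := hN _ h
      rw [show i + (K + (e - i)) = e + K by omega,
        show j + (K + (e - i)) = e + (j - i) + K by omega] at this
      exact absurd this hKne
    · exact h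
    · exact absurd (h1 N h) hN'
  have hτ : e + (j - i) + (K - n) = j + (N - n) := by omega
  rw [hτ] at hs hall
  refine ⟨e, hie, hrj, he, fun r hr => hemin r (by omega) hr, hcons, hs, ?_, ?_, k, ?_⟩
  · rwa [show j + N = e + (j - i) + K by omega]
  · intro r h1 h2
    refine hall r ?_ h1 h2
    by_contra h
    exact hemin r (by omega) (by omega) h2
  · rw [show e + (j - i) - e = j - i by omega] at hk
    omega

/-- The conclusions about the first repetition which only involve lengths and positions of
repetitions. -/
theorem FirstRepeat.exists_repetitions (hx : NotEventuallyPeriodic x)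
    (hp : subwordComplexity x (n + 1) = subwordComplexity x n + 1) {i j N : ℕ}
    (hr : FirstRepeat x n i j) (hnN : n ≤ N) (hN : BlockEq x N i j)
    (hN' : x (i + N) ≠ x (j + N)) :
    ∃ e j' K, i ≤ e ∧ n + e ≤ N + i ∧ e < j' ∧ n ≤ K ∧ j' + n ≤ subwordComplexity x n + N + 1 ∧
      j ≤ subwordComplexity x n ∧
      ((i + n + 1 ≤ subwordComplexity x n ∧ ∃ h u, u < j' ∧ BlockEq x (K + h) u j' ∧
          BlockEq x (n + (j - i)) e (j' + h + (K - n))) ∨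
        ∃ h i', i' < i ∧ e = i' + h ∧ i' + n + 1 ≤ subwordComplexity x n ∧
          (∀ n', N < n' → n' ≤ n + h → FirstRepeat x n' i' j') ∧
          (∃ u < j' + (i - i'), BlockEq x (K + (e - i)) u (j' + (i - i'))) ∧
          BlockEq x (n + (j - i) + h) i' (j' + (K - n)) ∧
          (N + i = n + e ∨ n + e + (j - i) ≤ N + i)) := by
  classical
  obtain ⟨e, hie, hej, he, hemin, hcons, hτs, hτl, hτall, k, hk⟩ := hr.exists_run hx hp hnN hN hN'
  obtain ⟨hij, hE, hmin⟩ := hr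
  obtain ⟨τ, hτ⟩ : ∃ τ, τ = j + (N - n) := ⟨_, rfl⟩
  rw [← hτ] at hτs hτall hk
  have hτl' : x (τ + n) ≠ x (e + n) := by rwa [show τ + n = j + N by omega]
  obtain ⟨α, hα⟩ : ∃ α, α = j - i := ⟨_, rfl⟩
  rw [← hα] at hcons hk ⊢
  have hαpos : 0 < α := by omega
  -- the first repetition after the run
  have hex : ∃ t, τ < t ∧ ∃ u < t, BlockEq x n u t := by
    obtain ⟨s, t, hs, hst, h⟩ := exists_blockEq_lt x n (τ + 1)
    exact ⟨t, by omega, s, hst, h⟩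
  obtain ⟨j', ⟨hj', u', hu', hEj'⟩, hj'min⟩ : ∃ t, (τ < t ∧ ∃ u < t, BlockEq x n u t) ∧
      ∀ t' < t, ¬ (τ < t' ∧ ∃ u < t', BlockEq x n u t') :=
    ⟨Nat.find hex, Nat.find_spec hex, fun t' h => Nat.find_min hex h⟩
  have hnew : ∀ u t, τ < t → t < j' → u < t → ¬ BlockEq x n u t :=
    fun u t h1 h2 h3 h4 => hj'min t h2 ⟨h1, u, h3, h4⟩
  have hnos : ∀ r, τ < r → r < j' → ¬ RightSpecialAt x n r :=
    fun r h1 h2 h3 => hnew τ r h1 h2 h1 (hτs.blockEq hp h3)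
  have hle : ∀ u < j', BlockEq x n u j' → u ≤ τ := by
    intro u h1 h2
    by_contra h
    obtain ⟨r, h3, h4, h5⟩ := exists_special_of_blockEq hx h1 h2
    exact hnos r (by omega) h4 h5
  -- The blocks at positions below `j` and strictly between `τ` and `j'` are pairwise distinct.
  have hcard : j + (j' - τ - 1) ≤ subwordComplexity x n := by
    have hd : Disjoint (Finset.range j) (Finset.Ioo τ j') := by
      rw [Finset.disjoint_left]
      intro a ha hb
      rw [Finset.mem_range] at ha
      rw [Finset.mem_Ioo] at hb
      omega
    have h1 : ∀ u t, t ∈ Finset.range j ∪ Finset.Ioo τ j' → u < t → ¬ BlockEq x n u t := by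
      intro u t ht hut h
      rw [Finset.mem_union, Finset.mem_range, Finset.mem_Ioo] at ht
      rcases ht with ht | ht
      · have := hmin u t hut h
        omega
      · exact hnew u t ht.1 ht.2 hut h
    have := card_le_subwordComplexity (x := x) (n := n) (Finset.range j ∪ Finset.Ioo τ j') ?_
    · rwa [Finset.card_union_of_disjoint hd, Finset.card_range, Nat.card_Ioo] at this
    · intro u hu t ht h
      rcases lt_trichotomy u t with hlt | heq | hlt
      · exact absurd h (h1 u t ht hlt)
      · exact heq
      · exact absurd h.symm (h1 t u hu hlt)
  -- the shifted word has few blocks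
  have hshift : ∀ i₀ u, i₀ ≤ i → i₀ ≤ u → u ≤ τ → BlockEq x n u j' →
      i₀ + n + 1 ≤ subwordComplexity x n := by
    intro i₀ u h1 h2 h3 h4
    have red1 : ∀ w, i₀ ≤ w → w ≤ τ → ∃ w', i₀ ≤ w' ∧ w' < j ∧ BlockEq x n w' w := by
      intro w
      induction w using Nat.strong_induction_on with
      | _ w ih =>
        intro hw hw'
        by_cases hwj : w < j
        · exact ⟨w, hw, hwj, BlockEq.refl x n w⟩
        · obtain ⟨w', h5, h6, h7⟩ := ih (w - α) (by omega) (by omega) (by omega)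
          refine ⟨w', h5, h6, h7.trans ?_⟩
          have := hN.shift (m := n) (w - j) (by omega)
          rwa [show i + (w - j) = w - α by omega, show j + (w - j) = w by omega] at this
    have red : ∀ w, i₀ ≤ w → w ≤ j' → ∃ w', i₀ ≤ w' ∧ (w' < j ∨ τ < w' ∧ w' < j') ∧
        BlockEq x n w' w := by
      intro w hw hw'
      rcases hw'.eq_or_lt with rfl | hw'
      · obtain ⟨w', h5, h6, h7⟩ := red1 u h2 h3
        exact ⟨w', h5, Or.inl h6, h7.trans h4⟩
      · by_cases hwτ : w ≤ τ
        · obtain ⟨w', h5, h6, h7⟩ := red1 w hw hwτ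
          exact ⟨w', h5, Or.inl h6, h7⟩
        · exact ⟨w, hw, Or.inr ⟨by omega, hw'⟩, BlockEq.refl x n w⟩
    -- These representatives are closed under moving one letter on: at a special block, `e` and `τ`
    -- realise the two possible letters. Comparing their number with the Morse–Hedlund bound for the
    -- shifted word yields the claim.
    have cov : ∀ d, ∃ w', i₀ ≤ w' ∧ (w' < j ∨ τ < w' ∧ w' < j') ∧ BlockEq x n w' (i₀ + d) := by
      intro d
      induction d with
      | zero => exact red i₀ le_rfl (by omega)
      | succ d ih =>
        obtain ⟨w, hw, hw', h⟩ := ih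
        have hwj : w < j' := by omega
        have fin : ∀ v, i₀ ≤ v → v < j' → BlockEq x n (v + 1) (i₀ + (d + 1)) →
            ∃ w', i₀ ≤ w' ∧ (w' < j ∨ τ < w' ∧ w' < j') ∧ BlockEq x n w' (i₀ + (d + 1)) := by
          intro v hv hv' hvE
          obtain ⟨w', h5, h6, h7⟩ := red (v + 1) (by omega) (by omega)
          exact ⟨w', h5, h6, h7.trans hvE⟩
        by_cases hs : RightSpecialAt x n w
        · have hs' := hs.congr h
          by_cases ha : x (i₀ + d + n) = x (e + n)
          · exact fin e (by omega) (by omega) ((he.blockEq hp hs').next ha.symm)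
          · exact fin τ (by omega) (by omega)
              ((hτs.blockEq hp hs').next (eq_of_special_of_ne hp he hτs hs' hτl' ha))
        · exact fin w hw hwj (h.next_of_not_special hs)
    have hlow := lt_subwordComplexity (hx.shift i₀) n
    have hup := subwordComplexity_le_card (x := fun k => x (i₀ + k)) (n := n)
      ((Finset.Ico i₀ j ∪ Finset.Ioo τ j').image (· - i₀)) ?_
    · have h5 := Finset.card_image_le (s := Finset.Ico i₀ j ∪ Finset.Ioo τ j') (f := (· - i₀))
      have h6 := Finset.card_union_le (Finset.Ico i₀ j) (Finset.Ioo τ j')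
      rw [Nat.card_Ico, Nat.card_Ioo] at h6
      omega
    · intro d
      obtain ⟨w, h5, h6, h7⟩ := cov d
      refine ⟨w - i₀, Finset.mem_image.2 ⟨w, ?_, rfl⟩, ?_⟩
      · rw [Finset.mem_union, Finset.mem_Ico, Finset.mem_Ioo]
        omega
      · rw [blockEq_shift_iff]
        rwa [show i₀ + (w - i₀) = w by omega]
  -- loops starting like the first one have the same length
  have hloop : ∀ r, RightSpecialAt x n r → x (r + n) = x (e + n) → BlockEq x (n + α) e r := by
    intro r hs hl
    have h1 := (he.blockEq hp hs).succ hl.symm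
    have h2 := ((h1.shift (m := n) 1 (by omega)).advance (α - 1)
      fun w hw hw' => hcons w (by omega) (by omega)).2
    have := h1.join h2 rfl rfl (by omega)
    rwa [show n + (α - 1) + 1 = n + α by omega] at this
  have hnoτ : ∀ r, τ < r + α → r < τ → ¬ RightSpecialAt x n r := by
    intro r h1 h2 h3
    have h4 := (hloop r h3 (hτall r h2 h3)).shift (m := n) (τ - r) (by omega)
    rw [show r + (τ - r) = τ by omega] at h4
    exact hcons _ (by omega) (by omega) (hτs.congr h4.symm)
  -- the second run
  obtain ⟨τ', hττ', hτ's, hτ'min⟩ := exists_next_special hx n (τ + 1)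
  have hj'τ' : j' ≤ τ' := by
    by_contra h
    exact hnos τ' (by omega) (by omega) hτ's
  obtain ⟨K, hnK, hK, -, hρs, hρl, -, q, hq⟩ := exists_special_run hx hp (by omega) hτs hτ's
    fun r h1 h2 => hτ'min r (by omega) h2
  -- With only two extensions available, the letter ending the second run is that of the first loop.
  have hρ : BlockEq x (n + α) e (τ' + (K - n)) := by
    refine hloop _ hρs (eq_of_special_of_ne hp hτs hρs he ?_ hτl'.symm)
    rwa [show τ' + (K - n) + n = τ' + K by omega]
  have hτ'eq : ∀ u r, BlockEq x n u j' → u ≤ r → RightSpecialAt x n r →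
      (∀ w, u ≤ w → w < r → ¬ RightSpecialAt x n w) →
      τ' = j' + (r - u) ∧ BlockEq x (n + (r - u)) u j' := by
    intro u r h1 h2 h3 h4
    obtain ⟨h5, h6, h7⟩ := h1.advance_to_special h2 h3 h4
    refine ⟨?_, h5⟩
    rcases lt_trichotomy τ' (j' + (r - u)) with h | h | h
    · exact absurd hτ's (h7 _ hj'τ' h)
    · exact h
    · exact absurd h6 (hτ'min _ (by omega) h)
  refine ⟨e, j', K, hie, ?_, by omega, hnK, by omega, by omega, ?_⟩
  · have : 0 ≤ k * α := Nat.zero_le _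
    omega
  -- Either the block at `j'` already occurs in `[i, τ]`, or its earlier occurrences are all before
  -- `i`.
  by_cases hY : ∃ u, i ≤ u ∧ u ≤ τ ∧ BlockEq x n u j'
  · left
    obtain ⟨u, h1, h2, h3⟩ := hY
    refine ⟨hshift i u le_rfl h1 h2 h3, ?_⟩
    have hdiv := Nat.div_add_mod (τ - u) α
    have hmod := Nat.mod_lt (τ - u) hαpos
    rw [mul_comm] at hdiv
    -- Moving `u` by multiples of the period `α` reaches the last loop before `τ`, where the next
    -- special position is `τ`.
    obtain ⟨v, hv⟩ : ∃ v, v = u + (τ - u) / α * α := ⟨_, rfl⟩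
    have h4 : BlockEq x n u v := by
      rw [hv]
      refine BlockEq.periodic (s := i) (M := N) ?_ h1 _ (by omega)
      rwa [show i + α = j by omega]
    obtain ⟨h5, h6⟩ := hτ'eq v τ (h4.symm.trans h3) (by omega) hτs
      fun w hw hw' => hnoτ w (by omega) hw'
    refine ⟨τ - v, v, by omega, h6.join hK (by omega) h5 (by omega), ?_⟩
    rwa [← h5]
  · right
    have hi' : u' < i := by
      by_contra h
      exact hY ⟨u', by omega, hle u' hu' hEj', hEj'⟩
    obtain ⟨h5, h6⟩ := hτ'eq u' e hEj' (by omega) he fun w _ hw' => hemin w hw'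
    refine ⟨e - u', u', hi', by omega, hshift u' u' hi'.le le_rfl (by omega) hEj', ?_, ?_, ?_, ?_⟩
    -- Since `n' > N`, a repetition with `j ≤ t ≤ τ` would include the block at `τ` with its next
    -- letter, which no earlier special position has.
    · intro n' h7 h8
      refine ⟨hu', h6.mono h8, fun u t hut h => ?_⟩
      by_contra hlt
      have h9 := hmin u t hut (h.mono (by omega))
      have h10 : t ≤ τ := by
        by_contra h'
        exact hnew u t (by omega) (by omega) hut (h.mono (by omega))
      have h11 := h.shift (m := n + 1) (τ - t) (by omega)
      rw [show t + (τ - t) = τ by omega] at h11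
      refine hτl' ?_
      rw [← h11 n (by omega)]
      exact hτall _ (by omega) (hτs.congr (h11.mono (by omega)).symm)
    · have h7 : BlockEq x n i (i + (k + 1) * α) := by
        refine BlockEq.periodic (s := i) (M := N) ?_ le_rfl _ ?_
        · rwa [show i + α = j by omega]
        · rw [Nat.succ_mul]
          omega
      have h8 : BlockEq x n i (j' + (i - u')) := by
        have := h6.shift (m := n) (i - u') (by omega)
        rwa [show u' + (i - u') = i by omega] at this
      have h9 : i + (k + 1) * α + (e - i) = τ := by
        rw [Nat.succ_mul]
        omega
      obtain ⟨h10, -, h11⟩ := h7.advance_to_special hie he fun w _ hw' => hemin w hw'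
      obtain ⟨h12, -⟩ := ((h7.symm.trans h8).advance_to_special (r := τ) (by omega) hτs
        fun w hw hw' => h11 w hw (by omega))
      exact ⟨i + (k + 1) * α, by omega, h12.join hK (by omega) (by omega) (by omega)⟩
    · have h7 : BlockEq x n j' (j' + q * (τ' - τ)) := by
        refine BlockEq.periodic (s := τ) (M := K) ?_ hj'.le _ (by omega)
        rwa [show τ + (τ' - τ) = τ' by omega]
      rw [← hq] at h7
      obtain ⟨h8, -⟩ := (hEj'.trans h7).advance_to_special (r := e) (by omega) he
        fun w _ hw' => hemin w hw'
      exact h8.join hρ (by omega) (by omega) (by omega)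
    -- The first run consists of one loop exactly when `k = 0`.
    · rcases k with _ | k
      · left; omega
      · right
        rw [Nat.succ_mul] at hk
        have : 0 ≤ k * α := Nat.zero_le _
        omega

end Runs

/-! ### Growth of the complexity by at least two -/

section Growth

variable {A : Type*} [Finite A] {x : ℕ → A}

/-- Level `n` itself is only known to gain one; each of the next `d` levels gains two. -/
theorem subwordComplexity_growth (hx : NotEventuallyPeriodic x) {n : ℕ} (d : ℕ)
    (h : ∀ m, n < m → m ≤ n + d → subwordComplexity x (m + 1) ≠ subwordComplexity x m + 1) :
    subwordComplexity x n + 1 + 2 * d ≤ subwordComplexity x (n + d + 1) := by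
  induction d with
  | zero => exact subwordComplexity_lt_succ hx n
  | succ d ih =>
    have h1 := ih fun m hm hm' => h m hm (by omega)
    have h2 := subwordComplexity_lt_succ hx (n + d + 1)
    have h3 := h (n + d + 1) (by omega) (by omega)
    rw [show n + (d + 1) + 1 = n + d + 1 + 1 by omega]
    omega

theorem exists_subwordComplexity_succ_eq (hx : NotEventuallyPeriodic x) {δ : ℝ} (hδ : δ < 1)
    {n₀ : ℕ} (hC : ∀ n ≥ n₀, (subwordComplexity x n : ℝ) ≤ (1 + δ) * n) (m : ℕ) :
    ∃ n ≥ m, subwordComplexity x (n + 1) = subwordComplexity x n + 1 := by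
  by_contra! hno
  obtain ⟨d, hd⟩ := exists_nat_gt (2 * (m + 1) / (1 - δ))
  have h1 := subwordComplexity_growth hx (n := m) (d + n₀) fun k hk _ => hno k hk.le
  have h2 := hC (m + (d + n₀) + 1) (by omega)
  rw [div_lt_iff₀ (by linarith)] at hd
  have h3 : ((subwordComplexity x m + 1 + 2 * (d + n₀) : ℕ) : ℝ) ≤
      subwordComplexity x (m + (d + n₀) + 1) := by exact_mod_cast h1
  push_cast at h2 h3
  have h4 : (0 : ℝ) ≤ subwordComplexity x m := Nat.cast_nonneg _
  have h5 : (0 : ℝ) ≤ n₀ := Nat.cast_nonneg _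
  have h6 : (0 : ℝ) ≤ m := Nat.cast_nonneg _
  nlinarith

end Growth

/-! ### Numerical contradictions -/

section Inequalities

/-- Chaining `h2` with `h1` gives `c ^ 2 (n + (j - i)) ≤ (1 + c) j' - c n`. Then `h3` bounds `j'`,
`h4` and `h6` bound `j - i` from below, `h5` bounds `p`; the 5 absorbs bounded terms. -/
theorem first_case_inequality {c δ n N p i j j' K h : ℝ} (hδ : 0 ≤ δ) (hc : 0 < c) (hc1 : c ≤ 1)
    (hδ1 : δ ≤ 1) (hnN : n ≤ N) (h1 : c * (K + h) ≤ j') (h2 : c * (n + (j - i)) ≤ j' + h + (K - n))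
    (h3 : j' + n ≤ p + N + 1) (h4 : i + n + 1 ≤ p) (h5 : p + 1 + 2 * (N - n) ≤ (1 + δ) * (N + 1))
    (h6 : c * N ≤ j) : (c ^ 3 + c ^ 2 - 1 - δ * (1 + c + c ^ 2)) * N ≤ 5 := by
  have e1 : c ^ 2 * (n + (c * N - (p - n - 1))) ≤ (1 + c) * (p + N + 1 - n) - c * n := by
    have a1 : n + (c * N - (p - n - 1)) ≤ n + (j - i) := by linarith
    have a2 := mul_le_mul_of_nonneg_left a1 (sq_nonneg c)
    have a3 := mul_le_mul_of_nonneg_left h2 hc.le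
    have a4 := mul_le_mul_of_nonneg_left h3 (by linarith : 0 ≤ 1 + c)
    nlinarith
  have e2 := mul_le_mul_of_nonneg_left h5 (by positivity : 0 ≤ 1 + c + c ^ 2)
  have e3 : δ * c ≤ 1 := by nlinarith
  have e4 : δ * c ^ 2 ≤ 1 := by nlinarith
  nlinarith [sq_nonneg c]

/-- The same chaining; after `h5` is inserted, `hcδ` gives the terms in `h` a sign that lets them be
dropped. -/
theorem second_case_inequality {c δ n N p i j j' K h i' e : ℝ} (hδ : 0 ≤ δ) (hc : 0 < c)
    (hc1 : c ≤ 1) (hδ1 : δ ≤ 1) (hh : 0 ≤ h) (hcδ : 1 ≤ (1 - δ) * (1 + c + c ^ 2))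
    (hnN : n ≤ N) (he : e = i' + h) (hNe : N + i = n + e)
    (h1 : c * (K + (e - i)) ≤ j' + (i - i')) (h2 : c * (n + (j - i) + h) ≤ j' + (K - n))
    (h3 : j' + n ≤ p + N + 1) (h4 : i' + n + 1 ≤ p) (h5 : p + 1 + 2 * h ≤ (1 + δ) * (n + h + 1))
    (h6 : c * N ≤ j) : (c ^ 3 + c ^ 2 - 1 - δ * (1 + c + c ^ 2)) * n ≤ 5 := by
  have e1 : c ^ 2 * ((1 + c) * n - (p - n - 1)) ≤ (1 + c) * (p + 1) + h - c * n := by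
    have a1 : (1 + c) * n - (p - n - 1) ≤ n + (j - i) + h := by nlinarith
    have a2 := mul_le_mul_of_nonneg_left a1 (sq_nonneg c)
    have a3 := mul_le_mul_of_nonneg_left h2 hc.le
    have a4 := mul_le_mul_of_nonneg_left h3 hc.le
    subst he
    obtain rfl : i = n + (i' + h) - N := by linarith
    nlinarith
  have e2 := mul_le_mul_of_nonneg_left h5 (by positivity : 0 ≤ 1 + c + c ^ 2)
  have e3 : δ * c ≤ 1 := by nlinarith
  have e4 : δ * c ^ 2 ≤ 1 := by nlinarith
  have e5 := mul_le_mul_of_nonneg_right hcδ hh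
  nlinarith [sq_nonneg c]

theorem false_of_long_run_of_le {c δ n N p h i' : ℝ} (hc : 0 < c) (hc1 : c ≤ 1)
    (hcδ : 2 * (1 + δ) < 3 * c) (hn : 1 ≤ n) (hN : n + h ≤ N) (h1 : c * N ≤ i' + h + (N - n))
    (h2 : i' + n + 1 ≤ p) (h3 : c * N ≤ p) (h4 : p ≤ (1 + δ) * n) : False := by
  have b1 : 3 * n + 1 ≤ p + (2 - c) * N := by linarith
  have b2 := mul_le_mul_of_nonneg_left b1 hc.le
  have b3 := mul_le_mul_of_nonneg_left h3 (by linarith : 0 ≤ 2 - c)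
  have b4 := mul_le_mul_of_nonneg_right hcδ.le (by linarith : (0 : ℝ) ≤ n)
  linarith

theorem long_run_inequality {c δ n N p h i' : ℝ} (hδ : 0 ≤ δ) (hc1 : c ≤ 1)
    (hδ1 : δ ≤ 1) (hN : N ≤ n + h) (h1 : c * N ≤ i' + h + (N - n))
    (hi' : 0 ≤ i') (h2 : i' + n + 1 ≤ p) (h3 : p + 1 + 2 * h ≤ (1 + δ) * (n + h + 1)) :
    (c - 2 * δ) * n ≤ 1 := by
  have b1 : (1 - δ) * h ≤ δ * n := by linarith
  have b2 := mul_le_mul_of_nonneg_left hN (by linarith : 0 ≤ 1 - c)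
  have b3 : (c - δ) * n ≤ δ + (1 + δ - c) * h := by linarith
  have b4 := mul_le_mul_of_nonneg_left b3 (by linarith : 0 ≤ 1 - δ)
  have b5 := mul_le_mul_of_nonneg_left b1 (by linarith : 0 ≤ 1 + δ - c)
  have b6 : (c - 2 * δ) * n ≤ δ * (1 - δ) := by linarith
  have b7 : δ * (1 - δ) ≤ 1 := by nlinarith
  linarith

end Inequalities

/-! ### Low complexity against late repetitions -/

/-- A word of complexity at most `(1 + δ) n` contains early repetitions of arbitrarily long
blocks. -/
theorem false_of_complexity_le_of_repetition_ge {A : Type*} [Finite A] {x : ℕ → A}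
    (hx : NotEventuallyPeriodic x) {c δ : ℝ} (hδ : 0 ≤ δ) (hc : 0 < c) (hc1 : c ≤ 1)
    (hD : 0 < c ^ 3 + c ^ 2 - 1 - δ * (1 + c + c ^ 2)) {n₀ : ℕ}
    (hC : ∀ n ≥ n₀, (subwordComplexity x n : ℝ) ≤ (1 + δ) * n)
    (hH : ∀ L ≥ n₀, ∀ u t, u < t → BlockEq x L u t → c * L ≤ t) : False := by
  classical
  have hc3 : c ^ 3 ≤ 1 := pow_le_one₀ hc.le hc1
  have hc2 : c ^ 2 ≤ 1 := pow_le_one₀ hc.le hc1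
  have hcpos : 0 < 1 + c + c ^ 2 := by positivity
  have hδ1 : δ ≤ 1 := by nlinarith
  have hδlt : δ < 1 := by nlinarith
  have hcδ2 : 2 * δ < c := by nlinarith
  have hcδ3 : 2 * (1 + δ) < 3 * c := by
    have : 0 < c * (c ^ 2 - c + 1) := mul_pos hc (by nlinarith)
    nlinarith
  have hcδ : 1 ≤ (1 - δ) * (1 + c + c ^ 2) := by nlinarith
  obtain ⟨n₁, hn₁, hn₁D, hn₁c⟩ : ∃ n₁ : ℕ, n₀ ≤ n₁ ∧
      5 < (c ^ 3 + c ^ 2 - 1 - δ * (1 + c + c ^ 2)) * n₁ ∧ 1 < (c - 2 * δ) * n₁ := by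
    obtain ⟨a, ha⟩ := exists_nat_gt (5 / (c ^ 3 + c ^ 2 - 1 - δ * (1 + c + c ^ 2)))
    obtain ⟨b, hb⟩ := exists_nat_gt (1 / (c - 2 * δ))
    rw [div_lt_iff₀' hD] at ha
    rw [div_lt_iff₀' (by linarith)] at hb
    refine ⟨n₀ + a + b, by omega, ?_, ?_⟩
    · push_cast
      have : (0 : ℝ) ≤ (c ^ 3 + c ^ 2 - 1 - δ * (1 + c + c ^ 2)) * (n₀ + b) := by positivity
      linarith
    · push_cast
      have : (0 : ℝ) ≤ (c - 2 * δ) * (n₀ + a) :=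
        mul_nonneg (by linarith) (by positivity)
      linarith
  -- a level where the first repeated block occurs as early as possible
  have hex : ∃ i n j, n₁ ≤ n ∧ subwordComplexity x (n + 1) = subwordComplexity x n + 1 ∧
      FirstRepeat x n i j := by
    obtain ⟨n, hn, hp⟩ := exists_subwordComplexity_succ_eq hx hδlt hC n₁
    obtain ⟨i, j, h⟩ := exists_firstRepeat x n
    exact ⟨i, n, j, hn, hp, h⟩
  obtain ⟨i, ⟨m, j, hm, hpm, hrm⟩, himin⟩ : ∃ i, (∃ n j, n₁ ≤ n ∧
      subwordComplexity x (n + 1) = subwordComplexity x n + 1 ∧ FirstRepeat x n i j) ∧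
      ∀ i' < i, ¬ ∃ n j, n₁ ≤ n ∧ subwordComplexity x (n + 1) = subwordComplexity x n + 1 ∧
        FirstRepeat x n i' j :=
    ⟨Nat.find hex, Nat.find_spec hex, fun i' h => Nat.find_min hex h⟩
  obtain ⟨N, hmN, hN, hN'⟩ := exists_maximal_blockEq hx hrm.1 hrm.2.1
  obtain ⟨n, hmn, hnN, hp, hnmax⟩ : ∃ n, m ≤ n ∧ n ≤ N ∧
      subwordComplexity x (n + 1) = subwordComplexity x n + 1 ∧ ∀ k, n < k → k ≤ N →
        subwordComplexity x (k + 1) ≠ subwordComplexity x k + 1 := by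
    refine ⟨Nat.findGreatest (fun k => subwordComplexity x (k + 1) = subwordComplexity x k + 1) N,
      Nat.le_findGreatest hmN hpm, Nat.findGreatest_le N,
      Nat.findGreatest_spec (P := fun k => subwordComplexity x (k + 1) = subwordComplexity x k + 1)
        hmN hpm, fun k hk hk' => Nat.findGreatest_is_greatest
        (P := fun k => subwordComplexity x (k + 1) = subwordComplexity x k + 1) hk hk'⟩
  have hr : FirstRepeat x n i j :=
    ⟨hrm.1, hN.mono hnN, fun u t hut h => hrm.2.2 u t hut (h.mono hmn)⟩
  obtain ⟨e, j', K, hie, heN, hjj', hnK, hj'p, hjp, hcase⟩ :=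
    hr.exists_repetitions hx hp hnN hN hN'
  have hij := hr.1
  have hcN := hH N (by omega) i j hij hN
  have hnn₁ : (n₁ : ℝ) ≤ n := by exact_mod_cast hm.trans hmn
  have hpn := hC n (by omega)
  obtain ⟨p, hpdef⟩ : ∃ p, p = subwordComplexity x n := ⟨_, rfl⟩
  rw [← hpdef] at hj'p hjp hcase hpn
  have hnNr : (n : ℝ) ≤ N := by exact_mod_cast hnN
  have hj'pr : (j' + n : ℝ) ≤ p + N + 1 := by exact_mod_cast hj'p
  have hnKr : (n : ℝ) ≤ K := by exact_mod_cast hnK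
  have hDn := hn₁D.trans_le (mul_le_mul_of_nonneg_left hnn₁ hD.le)
  rcases hcase with ⟨hip, h, u, hu, hE1, hE2⟩ | ⟨h, i', hi', hei', hip, hnext, ⟨u, hu, hE1⟩, hE2, hm⟩
  · have h1 := hH _ (by omega) _ _ hu hE1
    have h2 := hH _ (by omega) _ _ (by omega) hE2
    have h5 := subwordComplexity_growth hx (n := n) (N - n) fun k hk hk' =>
      hnmax k hk (by omega)
    rw [← hpdef, show n + (N - n) + 1 = N + 1 by omega] at h5
    have h5' : ((p + 1 + 2 * (N - n) : ℕ) : ℝ) ≤ subwordComplexity x (N + 1) := by exact_mod_cast h5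
    have h5'' := hC (N + 1) (by omega)
    have hipr : (i + n + 1 : ℝ) ≤ p := by exact_mod_cast hip
    push_cast [Nat.cast_sub hnN, Nat.cast_sub hij.le, Nat.cast_sub hnK] at h1 h2 h5' h5''
    have := first_case_inequality hδ hc hc1 hδ1 hnNr h1 h2 hj'pr hipr (h5'.trans h5'') hcN
    exact absurd (this.trans_lt hDn) (mul_le_mul_of_nonneg_left hnNr hD.le).not_gt
  · have hipr : (i' + n + 1 : ℝ) ≤ p := by exact_mod_cast hip
    have hjpr : (j : ℝ) ≤ p := by exact_mod_cast hjp
    -- Up to `N`, growth one is excluded by the choice of `n`; beyond `N`, a level of growth one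
    -- would have its first repetition at `i' < i`.
    have hgrow : N < n + h → (p + 1 + 2 * h : ℝ) ≤ (1 + δ) * (n + h + 1) := by
      intro hNh
      have h5 := subwordComplexity_growth hx (n := n) h fun k hk hk' => by
        by_cases hkN : k ≤ N
        · exact hnmax k hk hkN
        · exact fun hpk => himin i' hi' ⟨k, j', by omega, hpk, hnext k (by omega) hk'⟩
      rw [← hpdef] at h5
      have h5' : ((p + 1 + 2 * h : ℕ) : ℝ) ≤ subwordComplexity x (n + h + 1) := by
        exact_mod_cast h5
      have h5'' := hC (n + h + 1) (by omega)
      push_cast at h5' h5''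
      exact h5'.trans h5''
    rcases hm with hm | hm
    · have h1 := hH _ (by omega) _ _ hu hE1
      have h2 := hH _ (by omega) _ _ (by omega) hE2
      have h5 := hgrow (by omega)
      push_cast [Nat.cast_sub hij.le, Nat.cast_sub hnK, Nat.cast_sub hie, Nat.cast_sub hi'.le]
        at h1 h2
      have := second_case_inequality (e := e) hδ hc hc1 hδ1 (Nat.cast_nonneg h) hcδ hnNr
        (by exact_mod_cast hei') (by exact_mod_cast hm) h1 h2 hj'pr hipr h5 hcN
      linarith
    · have b1 : (n + e + j : ℝ) ≤ N + i + i := by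
        have : n + e + j ≤ N + i + i := by omega
        exact_mod_cast this
      have b2 : (i : ℝ) ≤ e := by exact_mod_cast hie
      have b3 : (e : ℝ) = i' + h := by exact_mod_cast hei'
      have b4 : (0 : ℝ) ≤ h := Nat.cast_nonneg h
      have b5 : (1 : ℝ) ≤ n := by
        by_contra hlt
        have : n = 0 := by
          by_contra h0
          exact hlt (by exact_mod_cast Nat.one_le_iff_ne_zero.2 h0)
        rw [this] at hDn
        norm_num at hDn
      have hlong : c * N ≤ i' + h + (N - n) := by linarith
      by_cases hNh : n + h ≤ N
      · have b6 : (n + h : ℝ) ≤ N := by exact_mod_cast hNh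
        exact false_of_long_run_of_le hc hc1 hcδ3 b5 b6 hlong hipr (hcN.trans hjpr) hpn
      · have b6 : (N : ℝ) ≤ n + h := by
          have : N ≤ n + h := by omega
          exact_mod_cast this
        have b7 := long_run_inequality hδ hc1 hδ1 b6 hlong (Nat.cast_nonneg i') hipr
          (hgrow (by omega))
        have b8 := mul_le_mul_of_nonneg_left hnn₁ (by linarith : 0 ≤ c - 2 * δ)
        linarith

/-! ### Repetitions and rational approximations -/

section Approximation

variable {b : ℕ} [NeZero b] {ξ : ℝ}

/-- Shifting the expansion multiplies the number by a power of the base, up to an integer. -/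
theorem exists_int_pow_mul_eq (hb : 2 ≤ b) (ξ : ℝ) (u : ℕ) :
    ∃ a : ℤ, (b : ℝ) ^ u * ξ = a + Real.ofDigits fun k => baryExpansion ξ b (k + u) := by
  have hx : Int.fract ξ ∈ Set.Ico (0 : ℝ) 1 := ⟨Int.fract_nonneg ξ, Int.fract_lt_one ξ⟩
  have h1 := Real.ofDigits_eq_sum_add_ofDigits (baryExpansion ξ b) u
  have h2 : (b : ℝ) ^ u * ∑ i ∈ Finset.range u, Real.ofDigitsTerm (baryExpansion ξ b) i =
      ⌊(b : ℝ) ^ u * Int.fract ξ⌋₊ := Real.ofDigits_digits_sum_eq (b := b) hx u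
  have h3 : Real.ofDigits (baryExpansion ξ b) = Int.fract ξ :=
    Real.ofDigits_digits (by omega) hx
  have hb0 : (b : ℝ) ^ u ≠ 0 := pow_ne_zero _ (Nat.cast_ne_zero.mpr (NeZero.ne b))
  refine ⟨(b : ℤ) ^ u * ⌊ξ⌋ + ⌊(b : ℝ) ^ u * Int.fract ξ⌋₊, ?_⟩
  have h4 : (b : ℝ) ^ u * Int.fract ξ = ⌊(b : ℝ) ^ u * Int.fract ξ⌋₊ +
      Real.ofDigits fun k => baryExpansion ξ b (k + u) := by
    rw [← h2, ← mul_inv_cancel_left₀ hb0 (Real.ofDigits fun k => baryExpansion ξ b (k + u)),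
      ← mul_add, ← h1, h3]
  push_cast
  rw [add_assoc, ← h4, ← mul_add, Int.floor_add_fract]

/-- A repetition in the expansion gives a good rational approximation. -/
theorem BlockEq.exists_int_abs_sub_le (hb : 2 ≤ b) {L u t : ℕ}
    (h : BlockEq (baryExpansion ξ b) L u t) :
    ∃ a : ℤ, |((b : ℝ) ^ t - (b : ℝ) ^ u) * ξ - a| ≤ ((b : ℝ) ^ L)⁻¹ := by
  obtain ⟨p, hp⟩ := exists_int_pow_mul_eq hb ξ t
  obtain ⟨q, hq⟩ := exists_int_pow_mul_eq hb ξ u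
  refine ⟨p - q, ?_⟩
  have := Real.abs_ofDigits_sub_ofDigits_le (x := fun k => baryExpansion ξ b (k + t))
    (y := fun k => baryExpansion ξ b (k + u)) (n := L) fun k hk => by
      rw [add_comm k t, add_comm k u]
      exact (h k hk).symm
  rw [sub_mul, hp, hq]
  push_cast
  convert this using 2
  ring

theorem baryExpansion_notEventuallyPeriodic (hb : 2 ≤ b) (hξ : Irrational ξ) :
    NotEventuallyPeriodic (baryExpansion ξ b) := by
  intro s t hst
  by_contra! hno
  obtain ⟨p, hp⟩ := exists_int_pow_mul_eq hb ξ t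
  obtain ⟨q, hq⟩ := exists_int_pow_mul_eq hb ξ s
  have hfun : (fun k => baryExpansion ξ b (k + t)) = fun k => baryExpansion ξ b (k + s) := by
    funext k
    rw [add_comm k t, add_comm k s]
    exact (hno k).symm
  rw [hfun] at hp
  have hlt : (b : ℝ) ^ s < (b : ℝ) ^ t :=
    pow_lt_pow_right₀ (by exact_mod_cast hb) hst
  have h0 : (b : ℝ) ^ t - (b : ℝ) ^ s ≠ 0 := by linarith
  have h1 : ((b : ℝ) ^ t - (b : ℝ) ^ s) * ξ = p - q := by linarith
  refine hξ ⟨((p - q : ℤ) : ℚ) / (((b : ℤ) ^ t - (b : ℤ) ^ s : ℤ) : ℚ), ?_⟩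
  push_cast
  rw [← h1, mul_div_cancel_left₀ _ h0]

/-- If the irrationality exponent is less than `m`, then the repetitions of long blocks occur
late. -/
theorem exists_forall_repetition_ge (hb : 2 ≤ b) (hξ : Irrational ξ) {m : ℝ} (hm : 1 < m)
    (hμ : irrationalityExponent ξ < (m : EReal)) :
    ∃ n₀ : ℕ, ∀ L ≥ n₀, ∀ u t, u < t → BlockEq (baryExpansion ξ b) L u t →
      (m - 1)⁻¹ * L ≤ t := by
  by_contra! hno
  refine hμ.not_ge ?_
  unfold irrationalityExponent
  refine le_iSup₂_of_le m ?_ le_rfl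
  intro hfin
  have hb1 : (1 : ℝ) < b := by exact_mod_cast hb
  -- the distance to the finitely many approximations
  obtain ⟨ε, hε, hεr⟩ : ∃ ε > 0, ∀ r ∈ {r : ℚ | ∃ (p : ℤ) (q : ℕ), 1 ≤ q ∧ r = (p : ℚ) / (q : ℚ) ∧
      |ξ - (p : ℝ) / (q : ℝ)| < 1 / (q : ℝ) ^ m}, ε ≤ |ξ - r| := by
    rcases Set.eq_empty_or_nonempty {r : ℚ | ∃ (p : ℤ) (q : ℕ), 1 ≤ q ∧ r = (p : ℚ) / (q : ℚ) ∧
      |ξ - (p : ℝ) / (q : ℝ)| < 1 / (q : ℝ) ^ m} with he | hne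
    · exact ⟨1, one_pos, fun r hr => by rw [he] at hr; exact absurd hr (Set.notMem_empty r)⟩
    · obtain ⟨r₀, -, hr₀⟩ := Set.exists_min_image _ (fun r : ℚ => |ξ - r|) hfin hne
      exact ⟨|ξ - r₀|, abs_pos.2 (sub_ne_zero.2 (hξ.ne_rat r₀)), hr₀⟩
  -- Blocks longer than `n₀` give approximations closer than `ε`, hence outside the finite set.
  obtain ⟨n₀, hn₀⟩ := exists_pow_lt_of_lt_one hε (inv_lt_one_of_one_lt₀ hb1)
  obtain ⟨L, hL, u, t, hut, hE, htL⟩ := hno n₀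
  obtain ⟨a, ha⟩ := hE.exists_int_abs_sub_le hb
  have hbut : b ^ u < b ^ t := pow_lt_pow_right₀ (by omega) hut
  obtain ⟨Q, hQ⟩ : ∃ Q, Q = b ^ t - b ^ u := ⟨_, rfl⟩
  have hQ1 : 1 ≤ Q := by omega
  have hQr : (Q : ℝ) = (b : ℝ) ^ t - (b : ℝ) ^ u := by
    rw [hQ, Nat.cast_sub hbut.le]
    push_cast
    ring
  have hQ1r : (1 : ℝ) ≤ Q := by exact_mod_cast hQ1
  have hQ0 : (0 : ℝ) < Q := by linarith
  rw [← hQr] at ha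
  have hdist : |ξ - a / Q| ≤ ((b : ℝ) ^ L)⁻¹ / Q := by
    rw [le_div_iff₀ hQ0]
    calc |ξ - a / Q| * Q = |(ξ - a / Q) * Q| := by rw [abs_mul, abs_of_pos hQ0]
      _ = |Q * ξ - a| := by congr 1; field_simp
      _ ≤ _ := ha
  have hsmall : ((b : ℝ) ^ L)⁻¹ / Q < 1 / (Q : ℝ) ^ m := by
    have h1 : (Q : ℝ) ^ (m - 1) < (b : ℝ) ^ L := by
      calc (Q : ℝ) ^ (m - 1) ≤ ((b : ℝ) ^ t) ^ (m - 1) := by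
            refine Real.rpow_le_rpow hQ0.le ?_ (by linarith)
            rw [hQr]
            have : (0 : ℝ) ≤ (b : ℝ) ^ u := by positivity
            linarith
        _ = (b : ℝ) ^ ((t : ℝ) * (m - 1)) := by
            rw [Real.rpow_mul (by linarith), Real.rpow_natCast]
        _ < (b : ℝ) ^ (L : ℝ) := by
            refine Real.rpow_lt_rpow_of_exponent_lt hb1 ?_
            rw [inv_mul_eq_div, lt_div_iff₀ (by linarith)] at htL
            exact htL
        _ = _ := Real.rpow_natCast _ _
    have h2 : (Q : ℝ) ^ m = (Q : ℝ) ^ (m - 1) * Q := by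
      rw [Real.rpow_sub_one hQ0.ne', div_mul_cancel₀ _ hQ0.ne']
    have h3 : 0 < (Q : ℝ) ^ (m - 1) := Real.rpow_pos_of_pos hQ0 _
    rw [h2, ← div_div, one_div]
    exact div_lt_div_of_pos_right ((inv_lt_inv₀ (by positivity) h3).2 h1) hQ0
  have hmem := hεr ((a : ℚ) / (Q : ℚ)) ⟨a, Q, hQ1, rfl, hdist.trans_lt hsmall⟩
  have h4 : ((b : ℝ) ^ L)⁻¹ / Q ≤ ((b : ℝ)⁻¹) ^ n₀ := by
    refine (div_le_self (by positivity) hQ1r).trans ?_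
    rw [← inv_pow]
    exact pow_le_pow_of_le_one (by positivity) (inv_le_one_of_one_le₀ hb1.le) hL
  push_cast at hmem
  linarith

end Approximation

/-! ### From the cubic condition to the stated bounds -/

/-- A lower bound of the complexity in terms of an upper bound of the irrationality exponent. -/
theorem not_eventually_complexityInBase_le {b : ℕ} [NeZero b] (hb : 2 ≤ b) {ξ : ℝ}
    (hξ : Irrational ξ) {t δ : ℝ} (ht : 0 ≤ t) (hδ : 0 ≤ δ)
    (hμ : irrationalityExponent ξ = ((2 + t : ℝ) : EReal))
    (hD : 0 < 1 - 2 * t - 3 * t ^ 2 - t ^ 3 - δ * (3 + 6 * t + 4 * t ^ 2 + t ^ 3)) :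
    ¬ ∀ᶠ n : ℕ in atTop, (complexityInBase n ξ b : ℝ) ≤ (1 + δ) * n := by
  intro hC
  obtain ⟨n₁, hn₁⟩ := eventually_atTop.1 hC
  obtain ⟨s, hts, hs⟩ : ∃ s > t,
      0 < 1 - 2 * s - 3 * s ^ 2 - s ^ 3 - δ * (3 + 6 * s + 4 * s ^ 2 + s ^ 3) := by
    have hcont : Continuous fun s : ℝ =>
        1 - 2 * s - 3 * s ^ 2 - s ^ 3 - δ * (3 + 6 * s + 4 * s ^ 2 + s ^ 3) := by fun_prop
    have h1 := (hcont.continuousAt (x := t)).eventually (lt_mem_nhds hD)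
    have h2 : ∀ᶠ s in nhdsWithin t (Set.Ioi t),
        0 < 1 - 2 * s - 3 * s ^ 2 - s ^ 3 - δ * (3 + 6 * s + 4 * s ^ 2 + s ^ 3) :=
      nhdsWithin_le_nhds h1
    obtain ⟨s, hs, hs'⟩ := (h2.and self_mem_nhdsWithin).exists
    exact ⟨s, hs', hs⟩
  obtain ⟨n₀, hn₀⟩ := exists_forall_repetition_ge (b := b) hb hξ (m := 2 + s) (by linarith)
    (by rw [hμ]; exact_mod_cast (by linarith : 2 + t < 2 + s))
  have hs1 : 0 < 1 + s := by linarith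
  rw [show 2 + s - 1 = 1 + s by ring] at hn₀
  refine false_of_complexity_le_of_repetition_ge (baryExpansion_notEventuallyPeriodic hb hξ)
    (c := (1 + s)⁻¹) hδ (by positivity) (inv_le_one_of_one_le₀ (by linarith)) ?_
    (n₀ := max n₀ n₁) (fun n hn => hn₁ n (le_of_max_le_right hn))
    fun L hL u v => hn₀ L (le_of_max_le_left hL) u v
  have : (1 + s)⁻¹ ^ 3 + (1 + s)⁻¹ ^ 2 - 1 - δ * (1 + (1 + s)⁻¹ + (1 + s)⁻¹ ^ 2) =
      (1 - 2 * s - 3 * s ^ 2 - s ^ 3 - δ * (3 + 6 * s + 4 * s ^ 2 + s ^ 3)) / (1 + s) ^ 3 := by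
    field_simp
    ring
  rw [this]
  positivity

theorem le_limsup_complexityInBase {b : ℕ} [NeZero b] (hb : 2 ≤ b) {ξ : ℝ}
    (hξ : Irrational ξ) {t δ : ℝ} (ht : 0 ≤ t) (hδ : 0 < δ)
    (hμ : irrationalityExponent ξ = ((2 + t : ℝ) : EReal))
    (hD : 0 ≤ 1 - 2 * t - 3 * t ^ 2 - t ^ 3 - δ * (3 + 6 * t + 4 * t ^ 2 + t ^ 3)) :
    ((1 + δ : ℝ) : EReal) ≤
      limsup (fun n : ℕ => (((complexityInBase n ξ b : ℝ) / (n : ℝ) : ℝ) : EReal)) atTop := by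
  by_contra! hlt
  obtain ⟨r, hr, hr'⟩ := EReal.lt_iff_exists_real_btwn.1 hlt
  have hr'' : r < 1 + δ := by exact_mod_cast hr'
  have hev := eventually_lt_of_limsup_lt hr
  have hpos : 0 < 3 + 6 * t + 4 * t ^ 2 + t ^ 3 := by positivity
  refine not_eventually_complexityInBase_le hb hξ ht (le_max_left 0 (r - 1)) hμ ?_ ?_
  · have : max 0 (r - 1) < δ := max_lt hδ (by linarith)
    nlinarith
  · filter_upwards [hev, eventually_gt_atTop 0] with n hn hn0
    have hn0' : (0 : ℝ) < n := by exact_mod_cast hn0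
    have h1 : (complexityInBase n ξ b : ℝ) / n < r := by exact_mod_cast hn
    rw [div_lt_iff₀ hn0'] at h1
    have h2 : r ≤ 1 + max 0 (r - 1) := by linarith [le_max_right 0 (r - 1)]
    nlinarith

theorem one_le_limsup_complexityInBase {b : ℕ} [NeZero b] (hb : 2 ≤ b) {ξ : ℝ}
    (hξ : Irrational ξ) :
    ((1 : ℝ) : EReal) ≤
      limsup (fun n : ℕ => (((complexityInBase n ξ b : ℝ) / (n : ℝ) : ℝ) : EReal)) atTop := by
  refine le_limsup_of_frequently_le (Eventually.frequently ?_)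
  filter_upwards [eventually_gt_atTop 0] with n hn0
  have hn0' : (0 : ℝ) < n := by exact_mod_cast hn0
  have h := lt_subwordComplexity (baryExpansion_notEventuallyPeriodic hb hξ) n
  have h1 : (1 : ℝ) ≤ (complexityInBase n ξ b : ℝ) / n := by
    rw [le_div_iff₀ hn0', one_mul]
    exact_mod_cast h.le
  exact_mod_cast h1

theorem theorem3 (b : ℕ) [NeZero b] (hb : 2 ≤ b) (ξ : ℝ) (hξ : Irrational ξ) :
    (irrationalityExponent ξ = 2 →
      ((4 / 3 : ℝ) : EReal) ≤
        limsup (fun n : ℕ => (((complexityInBase n ξ b : ℝ) / (n : ℝ) : ℝ) : EReal)) atTop) ∧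
    (∀ μ : ℝ, irrationalityExponent ξ = (μ : EReal) → 2 < μ →
      ((1 + (μ + 1 - Real.sqrt (81 * (μ - 2) ^ 2 - 10 * μ + 29)) / (8 * (μ - 2)) : ℝ) : EReal) ≤
        limsup (fun n : ℕ => (((complexityInBase n ξ b : ℝ) / (n : ℝ) : ℝ) : EReal)) atTop) := by
  constructor
  · intro hμ
    have := le_limsup_complexityInBase (b := b) hb hξ (t := 0) (δ := 1 / 3) le_rfl (by norm_num)
      (by rw [hμ, add_zero]; rfl) (by norm_num)
    rwa [show (1 + 1 / 3 : ℝ) = 4 / 3 by norm_num] at this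
  · intro μ hμ hμ2
    obtain ⟨t, rfl⟩ : ∃ t, μ = 2 + t := ⟨μ - 2, by ring⟩
    have ht : 0 < t := by linarith
    obtain ⟨S, hS⟩ : ∃ S, S = Real.sqrt (81 * (2 + t - 2) ^ 2 - 10 * (2 + t) + 29) := ⟨_, rfl⟩
    have hS0 : 0 ≤ S := hS ▸ Real.sqrt_nonneg _
    have hSsq : S ^ 2 = 81 * t ^ 2 - 10 * t + 9 := by
      rw [hS, Real.sq_sqrt]
      · ring
      · nlinarith [sq_nonneg (9 * t - 5 / 9)]
    rw [← hS]
    obtain ⟨δ, hδ⟩ : ∃ δ, δ = (2 + t + 1 - S) / (8 * (2 + t - 2)) := ⟨_, rfl⟩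
    rw [← hδ]
    by_cases hδ0 : 0 < δ
    · refine le_limsup_complexityInBase hb hξ ht.le hδ0 hμ ?_
      have hSδ : S = 3 + t - 8 * t * δ := by
        rw [hδ, add_sub_cancel_left]
        field_simp
        ring
      rw [hSδ] at hSsq hS0
      -- The quadratic of which `δ` is a root; it turns the cubic condition into `t` times the
      -- quantity in `hpos`.
      have hquad : 1 - 3 * δ = t * ((5 - 4 * δ) * (1 + δ)) := by
        have : t * (1 - 3 * δ - t * ((5 - 4 * δ) * (1 + δ))) = 0 := by nlinarith
        rcases mul_eq_zero.1 this with h | h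
        · exact absurd h ht.ne'
        · linarith
      have hδ1 : δ ≤ 1 / 3 := by
        by_contra! hlt
        have h1 : 0 < (4 * δ - 5) * (1 + δ) := by nlinarith
        nlinarith [sq_nonneg (3 * δ - 1)]
      -- On `[0, 1/3]` the concave factor `(5 - 4δ)(1 + δ)` is least at `1/3`, with value `44/9`.
      have ht1 : t ≤ 9 / 44 * (1 - 3 * δ) := by
        have h1 : 44 / 9 ≤ (5 - 4 * δ) * (1 + δ) := by
          nlinarith [mul_nonneg (by linarith : 0 ≤ 1 / 3 - δ) (by linarith : 0 ≤ 4 * δ + 1 / 3)]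
        have := mul_le_mul_of_nonneg_left h1 ht.le
        linarith
      have hpos : 0 ≤ 3 - 5 * δ - 4 * δ ^ 2 - t * (3 + t + 4 * δ + t * δ) := by
        have h1 : t * (3 + t + 4 * δ + t * δ) ≤ 9 / 44 * (1 - 3 * δ) * 5 := by
          refine mul_le_mul ht1 ?_ (by positivity) (by linarith)
          nlinarith
        nlinarith
      have := mul_nonneg ht.le hpos
      linarith
    · refine le_trans ?_ (one_le_limsup_complexityInBase hb hξ)
      exact_mod_cast (by linarith : 1 + δ ≤ 1)
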